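/- Let $\mathcal H$ be a separable infinite-dimensional complex Hilbert space and let $U(\mathcal H)$ be its unitary group with the strong operator topology. Let $K$ be an abelian compact Lie group and let $\mathcal C\subset \mathrm{Irrep}(K)$ be a set of isomorphism classes of (continuous, finite-dimensional, complex) irreducible representations of $K$. For a continuous homomorphism $\alpha:K\to U(\mathcal H)$ and $V\in\mathrm{Irrep}(K)$, let $\mathcal H_\alpha^V\subset\mathcal H$ be the isotypical component, i.e. the image of the evaluation map $V\otimes \hom_K(V,\mathcal H_\alpha)\to\mathcal H_\alpha$, $v\otimes h\mapsto h(v)$, where $\mathcal H_\alpha$ denotes $\mathcal H$ with the action of $K$ through $\alpha$. Let $$\hom_{st}(K,U(\mathcal H))_{\mathcal C}=\{\alpha:K\to U(\mathcal H) \text{ continuous homomorphism}\mid \dim\mathcal H_\alpha^V=\infty \text{ for } V\in\mathcal C,\ \dim \mathcal H_\alpha^V=0\text{ for }V\notin\mathcal C\},$$ with the subspace topology of the compact-open topology on the space of continuous maps $K\to U(\mathcal H)$. **Theorem.** Let $B$ be a paracompact Hausdorff space of finite covering dimension (i.e. there is $n\in\mathbb N$ such that every open cover of $B$ has an open refinement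 covering $B$ in which each point lies in at most $n+1$ members), let $b_0\in B$, and let $f:B\to\hom_{st}(K,U(\mathcal H))_{\mathcal C}$ be continuous. Then there is a continuous map $\sigma:B\to U(\mathcal H)$ such that $\sigma(b)\,f(b_0)\,\sigma(b)^{-1}=f(b)$ for all $b\in B$; that is, $\sigma(b)\,f(b_0)(k)\,\sigma(b)^{-1}=f(b)(k)$ for all $b\in B$ and $k\in K$. -/

import Mathlib

open scoped Manifold ContDiff Topology

noncomputable section

namespace StableRep

/-- The group `U(H)` of unitary operators of a Hilbert space. This is a type synonym of
Mathlib's `unitary (H →L[ℂ] H)`, introduced so that it can carry the strong operator topology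
instead of the norm topology. -/
def UnitaryGroup (H : Type*) [NormedAddCommGroup H] [InnerProductSpace ℂ H] [CompleteSpace H] :
    Type _ :=
  unitary (H →L[ℂ] H)

section UnitaryGroup

variable {H : Type*} [NormedAddCommGroup H] [InnerProductSpace ℂ H] [CompleteSpace H]

instance : Group (UnitaryGroup H) := inferInstanceAs (Group (unitary (H →L[ℂ] H)))

/-- The bounded operator underlying a unitary. -/
def UnitaryGroup.toCLM (U : UnitaryGroup H) : H →L[ℂ] H := U.1

/-- The strong operator topology on `U(H)`: the topology of pointwise convergence on `H`,
with `H` carrying its norm topology. -/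
instance : TopologicalSpace (UnitaryGroup H) :=
  TopologicalSpace.induced (fun (U : UnitaryGroup H) (x : H) => U.toCLM x) Pi.topologicalSpace

theorem UnitaryGroup.toCLM_one : (1 : UnitaryGroup H).toCLM = 1 := rfl

theorem UnitaryGroup.toCLM_mul (U V : UnitaryGroup H) : (U * V).toCLM = U.toCLM * V.toCLM := rfl

theorem UnitaryGroup.continuous_iff {X : Type*} [TopologicalSpace X] {φ : X → UnitaryGroup H} :
    Continuous φ ↔ ∀ x : H, Continuous fun a => (φ a).toCLM x := by
  rw [continuous_induced_rng, continuous_pi_iff]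
  rfl

/-- The homomorphism `F α F⁻¹ : g ↦ F α(g) F⁻¹`, for `F ∈ U(H)` and a continuous homomorphism
`α : G → U(H)`. -/
def conj {G : Type*} [Group G] [TopologicalSpace G] (F : UnitaryGroup H)
    (α : G →ₜ* UnitaryGroup H) : G →ₜ* UnitaryGroup H where
  toFun g := F * α g * F⁻¹
  map_one' := by simp
  map_mul' g h := by simp [mul_assoc]
  continuous_toFun := by
    rw [UnitaryGroup.continuous_iff]
    intro x
    exact F.toCLM.continuous.comp
      (UnitaryGroup.continuous_iff.1 α.continuous_toFun (F⁻¹.toCLM x))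

end UnitaryGroup

section Irrep

variable (G : Type*) [Group G] [TopologicalSpace G]

/-- A continuous irreducible finite-dimensional complex representation of `G`, on some `ℂⁿ`. -/
structure IrrepModel where
  dim : ℕ
  rep : Representation ℂ G (Fin dim → ℂ)
  irreducible : rep.IsIrreducible
  continuous_rep : Continuous fun p : G × (Fin dim → ℂ) => rep p.1 p.2

/-- Isomorphism (linear `G`-equivariant equivalence) of irreducible representations. -/
instance IrrepModel.setoid : Setoid (IrrepModel G) where
  r V W := Nonempty (V.rep.Equiv W.rep)
  iseqv :=
    { refl := fun _ => ⟨Representation.Equiv.refl _⟩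
      symm := fun ⟨e⟩ => ⟨e.symm⟩
      trans := fun ⟨e⟩ ⟨e'⟩ => ⟨e.trans e'⟩ }

/-- `Irrep(G)`: the set of isomorphism classes of irreducible representations of `G`. -/
def Irrep : Type _ := Quotient (IrrepModel.setoid G)

end Irrep

section Isotypic

variable {G : Type*} [Group G] [TopologicalSpace G]
variable {H : Type*} [NormedAddCommGroup H] [InnerProductSpace ℂ H] [CompleteSpace H]

/-- The representation `H_α` of `G` on `H` given by a homomorphism `α : G → U(H)`. -/
def toRep (α : G →ₜ* UnitaryGroup H) : Representation ℂ G H where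
  toFun g := (α g).toCLM.toLinearMap
  map_one' := by ext x; simp [UnitaryGroup.toCLM_one]
  map_mul' g h := by ext x; simp [UnitaryGroup.toCLM_mul]

/-- The image of the evaluation map `V ⊗ Hom_G(V, H_α) → H`, `v ⊗ f ↦ f v`: the linear span of
the ranges of all `G`-equivariant linear maps `f : V → H_α`. -/
def isotypicModel (α : G →ₜ* UnitaryGroup H) (V : IrrepModel G) : Submodule ℂ H :=
  ⨆ f : V.rep.IntertwiningMap (toRep α), LinearMap.range f.toLinearMap

theorem isotypicModel_le (α : G →ₜ* UnitaryGroup H) (V W : IrrepModel G)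
    (e : W.rep.Equiv V.rep) : isotypicModel α V ≤ isotypicModel α W := by
  refine iSup_le fun f => ?_
  refine le_trans ?_ (le_iSup (fun f' : W.rep.IntertwiningMap (toRep α) =>
    LinearMap.range f'.toLinearMap) (f.comp e.toIntertwiningMap))
  rintro _ ⟨v, rfl⟩
  refine ⟨e.symm v, ?_⟩
  change f (e (e.symm v)) = f v
  simp

/-- The isotypical component `H_α^V` of `H_α` associated to a class `V ∈ Irrep(G)`. -/
def isotypic (α : G →ₜ* UnitaryGroup H) (V : Irrep G) : Submodule ℂ H :=
  Quotient.lift (s := IrrepModel.setoid G) (isotypicModel α)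
    (fun V W (h : Nonempty (V.rep.Equiv W.rep)) => h.elim fun e =>
      le_antisymm (isotypicModel_le α V W e.symm) (isotypicModel_le α W V e)) V

/-- A continuous homomorphism `α : G → U(H)` is stable if every isotypical component of `H_α` is
either zero or infinite dimensional. -/
def IsStable (α : G →ₜ* UnitaryGroup H) : Prop :=
  ∀ V : Irrep G, isotypic α V = ⊥ ∨ ¬ FiniteDimensional ℂ (isotypic α V)

end Isotypic

/-- `hom_st(G, U(H))_C`: the space of continuous homomorphisms `α : G → U(H)` that are stable and
for which the irreducible representations appearing in `H_α` are exactly those in `C`.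
As a subtype it has the subspace topology of `G →ₜ* UnitaryGroup H`, whose topology is the
compact-open topology. -/
def HomStable (G : Type*) [Group G] [TopologicalSpace G]
    (H : Type*) [NormedAddCommGroup H] [InnerProductSpace ℂ H] [CompleteSpace H]
    (C : Set (Irrep G)) : Set (G →ₜ* UnitaryGroup H) :=
  {α | IsStable α ∧ ∀ V : Irrep G, V ∈ C ↔ isotypic α V ≠ ⊥}

theorem mem_homStable_iff {G : Type*} [Group G] [TopologicalSpace G]
    {H : Type*} [NormedAddCommGroup H] [InnerProductSpace ℂ H] [CompleteSpace H]
    {C : Set (Irrep G)} {α : G →ₜ* UnitaryGroup H} :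
    α ∈ HomStable G H C ↔
      (∀ V ∉ C, isotypic α V = ⊥) ∧ ∀ V ∈ C, ¬ FiniteDimensional ℂ (isotypic α V) := by
  constructor
  · rintro ⟨hs, hC⟩
    exact ⟨fun V hV => not_not.1 fun h => hV ((hC V).2 h),
      fun V hV => (hs V).resolve_left ((hC V).1 hV)⟩
  · rintro ⟨h0, h1⟩
    refine ⟨fun V => ?_, fun V => ⟨fun hV h => h1 V hV ?_, fun h => ?_⟩⟩
    · by_cases hV : V ∈ C
      · exact Or.inr (h1 V hV)
      · exact Or.inl (h0 V hV)
    · rw [h]; infer_instance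
    · by_contra hV
      exact h (h0 V hV)

/-- The (Lebesgue) covering dimension of `B` is at most `n`: every open cover of `B` has an open
refinement that covers `B` and such that each point lies in at most `n + 1` of its members. -/
def CoveringDimLE (B : Type*) [TopologicalSpace B] (n : ℕ) : Prop :=
  ∀ 𝒰 : Set (Set B), (∀ U ∈ 𝒰, IsOpen U) → ⋃₀ 𝒰 = Set.univ →
    ∃ 𝒱 : Set (Set B), (∀ V ∈ 𝒱, IsOpen V) ∧ ⋃₀ 𝒱 = Set.univ ∧
      (∀ V ∈ 𝒱, ∃ U ∈ 𝒰, V ⊆ U) ∧ ∀ x : B, {V ∈ 𝒱 | x ∈ V}.encard ≤ n + 1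

/-- `B` has finite covering dimension. -/
def FiniteCoveringDim (B : Type*) [TopologicalSpace B] : Prop :=
  ∃ n : ℕ, CoveringDimLE B n

end StableRep

end

/-! Each weight space of `f b` carries a continuously varying orthonormal basis; together these form
a Hilbert basis `β b` of `H`, and `σ b` is the unitary taking `β b₀` to `β b`. It intertwines `f b₀`
with `f b` because corresponding basis vectors have the same weight.

Two facts carry this. The weight spaces span a dense subspace, by a Peter–Weyl argument
(`iSup_weightSpace_orthogonal`), and the projection onto the weight space of `χ` is the average of
`χ(k)⁻¹ f(b)(k)` over Haar measure, hence strongly continuous in `b`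
(`continuous_starProjection_weightSpace`). A weight space is the isotypical component of a
one-dimensional irreducible, so membership in `HomStable` makes it zero or infinite dimensional
independently of `b`.

The bases come from the Dixmier–Douady argument (`exists_orthonormal_basis`): split off unit
sections one at a time, each chosen so that the remaining projection is small on a member of a dense
sequence. Such a section exists because any section of an infinite-rank field over a
finite-dimensional base can be perturbed off zero (`exists_nonvanishing_section`). Locally the field
contains orthonormal frames longer than the dimension of the base, and a map into a space of that
dimension can be moved off the origin (`exists_nonvanishing_near`). -/

noncomputable section

namespace StableRep

/-! ### Dense sequences in general position -/

section GeneralPosition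

variable {F : Type*} [NormedAddCommGroup F] [NormedSpace ℂ F]

theorem dense_compl_submodule (W : Submodule ℂ F) (hW : W ≠ ⊤) : Dense ((W : Set F)ᶜ) := by
  rw [← interior_eq_empty_iff_dense_compl]
  by_contra h
  exact hW (W.eq_top_of_nonempty_interior' (Set.nonempty_iff_ne_empty.2 h))

/-- Baire category: only finitely many subsets of `S` are involved, and each has too few elements to
span `F`, so its span is closed with dense complement. -/
theorem exists_mem_ball_notMem_span [FiniteDimensional ℂ F] (S : Finset F) (z : F) {ε : ℝ} (hε : 0 < ε) :
    ∃ y, dist y z < ε ∧ ∀ t ⊆ S, t.card < Module.finrank ℂ F →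
      y ∉ Submodule.span ℂ (t : Set F) := by
  have := FiniteDimensional.complete ℂ F
  let T : Set (Finset F) := {t | t ⊆ S ∧ t.card < Module.finrank ℂ F}
  have hT : T.Countable :=
    ((Finset.finite_toSet S.powerset).subset fun t ht => by simpa using ht.1).countable
  have hd : Dense (⋂ t ∈ T, ((Submodule.span ℂ (t : Set F) : Set F)ᶜ)) := by
    refine dense_biInter_of_isOpen (fun t _ => ?_) hT fun t ht => dense_compl_submodule _ ?_
    · exact (Submodule.closed_of_finiteDimensional _).isOpen_compl
    · intro h
      have h1 := finrank_span_finset_le_card (R := ℂ) t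
      rw [Set.finrank, h, finrank_top] at h1
      exact absurd ht.2 (not_lt.2 h1)
  obtain ⟨y, hy, hyz⟩ := hd.exists_dist_lt z hε
  refine ⟨y, by rwa [dist_comm], fun t ht hc => ?_⟩
  simpa using Set.mem_iInter₂.1 hy t ⟨ht, hc⟩

/-- A dense sequence in general position. -/
theorem exists_denseRange_linearIndepOn [FiniteDimensional ℂ F] :
    ∃ y : ℕ → F, DenseRange y ∧
      ∀ t : Finset ℕ, t.card ≤ Module.finrank ℂ F → LinearIndepOn ℂ y (t : Set ℕ) := by
  classical
  have : ProperSpace F := FiniteDimensional.proper ℂ F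
  obtain ⟨z, hz⟩ := TopologicalSpace.exists_dense_seq F
  -- The `n`-th vector is taken within `1/(n+1)` of `z n.unpair.1`, so every `z k` is approached
  -- infinitely often and density survives.
  choose pick hdist hspan using fun (n : ℕ) (S : Finset F) =>
    exists_mem_ball_notMem_span S (z n.unpair.1) (Nat.one_div_pos_of_nat (α := ℝ) (n := n))
  let S : ℕ → Finset F := fun n => Nat.rec ∅ (fun n S => insert (pick n S) S) n
  have hS : ∀ n, S (n + 1) = insert (pick n (S n)) (S n) := fun n => rfl
  have hmono : Monotone S := monotone_nat_of_le_succ fun n => by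
    rw [hS]; exact Finset.subset_insert _ _
  let y : ℕ → F := fun n => pick n (S n)
  have hyS : ∀ i n, i < n → y i ∈ S n := fun i n h =>
    hmono (Nat.succ_le_of_lt h) (by rw [Nat.succ_eq_add_one, hS]; exact Finset.mem_insert_self _ _)
  refine ⟨y, ?_, ?_⟩
  · intro x
    rw [Metric.mem_closure_range_iff]
    intro ε hε
    obtain ⟨k, hk⟩ := Metric.denseRange_iff.1 hz x (ε / 2) (half_pos hε)
    obtain ⟨l, hl⟩ := exists_nat_one_div_lt (half_pos hε)
    refine ⟨Nat.pair k l, ?_⟩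
    have h1 := hdist (Nat.pair k l) (S (Nat.pair k l))
    rw [Nat.unpair_pair] at h1
    have h2 : (1 : ℝ) / ((Nat.pair k l : ℕ) + 1) ≤ 1 / (l + 1) :=
      Nat.one_div_le_one_div (Nat.right_le_pair k l)
    have h3 : dist (y (Nat.pair k l)) (z k) < ε / 2 := by
      refine lt_of_lt_of_le h1 ?_
      exact h2.trans hl.le
    calc dist x (y (Nat.pair k l)) ≤ dist x (z k) + dist (z k) (y (Nat.pair k l)) :=
          dist_triangle _ _ _
      _ < ε / 2 + ε / 2 := add_lt_add hk (by rwa [dist_comm])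
      _ = ε := add_halves ε
  · intro t
    induction t using Finset.induction_on_max with
    | empty => intro _; simp
    | insert a t ht ih =>
      intro hc
      have hat : a ∉ t := fun h => lt_irrefl _ (ht a h)
      rw [Finset.card_insert_of_notMem hat] at hc
      rw [Finset.coe_insert, linearIndepOn_insert (by simpa using hat)]
      refine ⟨ih (by omega), ?_⟩
      have := hspan a (S a) (t.image y) (fun w hw => by
        obtain ⟨i, hi, rfl⟩ := Finset.mem_image.1 hw
        exact hyS i a (ht i hi)) (lt_of_le_of_lt Finset.card_image_le (by omega))
      simpa using this

end GeneralPosition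

/-! ### Pushing maps into a finite-dimensional space off zero -/

section Nonvanishing

variable {B : Type*} [TopologicalSpace B]

/-- On a paracompact space of covering dimension at most `N`, zero is an unstable value of maps to
`ℂᵐ` for `N < m`. -/
theorem CoveringDimLE.exists_nonvanishing_near [T2Space B] [ParacompactSpace B] {N : ℕ}
    (hB : CoveringDimLE B N)
    {F : Type*} [NormedAddCommGroup F] [NormedSpace ℂ F] [FiniteDimensional ℂ F]
    (hF : N < Module.finrank ℂ F)
    {c : B → F} (hc : Continuous c) {δ : B → ℝ} (hδ : Continuous δ) (hδ0 : ∀ b, 0 < δ b) :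
    ∃ y : B → F, Continuous y ∧ (∀ b, y b ≠ 0) ∧ ∀ b, ‖y b - c b‖ < δ b := by
  classical
  obtain ⟨y, hy, hyi⟩ := exists_denseRange_linearIndepOn (F := F)
  let O : ℕ → Set B := fun n => {b | ‖y n - c b‖ < δ b}
  have hO : ∀ n, IsOpen (O n) := fun n =>
    isOpen_lt (continuous_const.sub hc).norm hδ
  have hcov : ⋃₀ Set.range O = Set.univ := by
    refine Set.eq_univ_of_forall fun b => ?_
    obtain ⟨n, hn⟩ := Metric.denseRange_iff.1 hy (c b) (δ b) (hδ0 b)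
    refine ⟨O n, ⟨n, rfl⟩, ?_⟩
    change ‖y n - c b‖ < δ b
    rwa [← dist_eq_norm, dist_comm]
  obtain ⟨𝒱, hVo, hVc, hVr, hVd⟩ := hB (Set.range O) (by rintro _ ⟨n, rfl⟩; exact hO n) hcov
  have : ∀ V : 𝒱, ∃ n, (V : Set B) ⊆ O n := fun V => by
    obtain ⟨_, ⟨n, rfl⟩, h⟩ := hVr V V.2
    exact ⟨n, h⟩
  choose ν hν using this
  -- Members of the refinement are grouped by index, so the number of `W n` containing a point is
  -- still at most `N + 1`.
  let W : ℕ → Set B := fun n => ⋃ V : {V : 𝒱 // ν V = n}, (V.1 : Set B)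
  have hWO : ∀ n, W n ⊆ O n := fun n => Set.iUnion_subset fun V => by
    obtain ⟨V, rfl⟩ := V
    exact hν V
  obtain ⟨ρ, hρ⟩ := PartitionOfUnity.exists_isSubordinate isClosed_univ W
    (fun n => isOpen_iUnion fun V => hVo _ V.1.2) (fun b _ => by
      obtain ⟨V, hV, hb⟩ : b ∈ ⋃₀ 𝒱 := by rw [hVc]; trivial
      exact Set.mem_iUnion.2 ⟨ν ⟨V, hV⟩, Set.mem_iUnion.2 ⟨⟨⟨V, hV⟩, rfl⟩, hb⟩⟩)
  have hsupp : ∀ n b, ρ n b ≠ 0 → b ∈ W n := fun n b h => hρ n (subset_tsupport _ h)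
  refine ⟨fun b => ∑ᶠ n, ρ n b • y n, ?_, fun b => ?_, fun b => ?_⟩
  · exact ρ.continuous_finsum_smul fun n b _ => continuousAt_const
  · have hcard : (ρ.finsupport b).card ≤ Module.finrank ℂ F := by
      have hch : ∀ n ∈ ρ.finsupport b, ∃ V : Set B, ∃ h : V ∈ 𝒱, ν ⟨V, h⟩ = n ∧ b ∈ V :=
        fun n hn => by
          obtain ⟨V, hV⟩ := Set.mem_iUnion.1 (hsupp n b (by simpa using hn))
          exact ⟨V.1, V.1.2, V.2, hV⟩
      choose! g hg using hch
      have h1 : ((ρ.finsupport b : Set ℕ)).encard ≤ {V ∈ 𝒱 | b ∈ V}.encard := by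
        refine Set.encard_le_encard_of_injOn (f := g) (fun n hn => ?_) fun n hn m hm h => ?_
        · obtain ⟨h, -, hb⟩ := hg n hn
          exact ⟨h, hb⟩
        · obtain ⟨h1, h2, -⟩ := hg n hn
          obtain ⟨h3, h4, -⟩ := hg m hm
          rw [← h2, ← h4]
          congr 2
      have h2 := h1.trans (hVd b)
      rw [Set.encard_coe_eq_coe_finsetCard] at h2
      have h3 : (ρ.finsupport b).card ≤ N + 1 := by exact_mod_cast h2
      omega
    intro h0
    have h1 : ∑ n ∈ ρ.finsupport b, ((ρ n b : ℝ) : ℂ) • y n = 0 := by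
      refine Eq.trans ?_ h0
      beta_reduce
      rw [← ρ.sum_finsupport_smul_eq_finsum (x₀ := b) (fun n _ => y n)]
      exact Finset.sum_congr rfl fun n _ => by simp
    -- At most `N + 1` of the `y n` enter at `b`, so they are independent; a vanishing sum would
    -- force all weights to be zero, although they add up to `1`.
    have h2 := linearIndepOn_finset_iff.1 (hyi _ hcard) (fun n => ((ρ n b : ℝ) : ℂ)) h1
    have h3 := ρ.sum_finsupport (Set.mem_univ b)
    rw [Finset.sum_eq_zero fun n hn => by simpa using h2 n hn] at h3
    exact zero_ne_one h3
  · have := ρ.finsum_smul_mem_convex (t := Metric.ball (c b) (δ b)) (g := fun n _ => y n)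
      (Set.mem_univ b) (fun n hn => ?_) (convex_ball _ _)
    · simpa [dist_eq_norm] using this
    · rw [Metric.mem_ball, dist_eq_norm]
      exact hWO n (hsupp n b hn)

end Nonvanishing

/-! ### Fields of infinite-rank projections and their continuous orthonormal bases -/

section ProjectionField

variable {B : Type*} [TopologicalSpace B]
variable {H : Type*} [NormedAddCommGroup H] [InnerProductSpace ℂ H]

/-- A strongly continuous family of orthogonal projections with infinite-dimensional ranges. -/
structure IsProjectionField (P : B → H →L[ℂ] H) : Prop where
  apply_apply : ∀ b x, P b (P b x) = P b x
  inner_apply : ∀ b x y, inner ℂ (P b x) y = inner ℂ x (P b y)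
  continuous_apply : ∀ x, Continuous fun b => P b x
  infinite : ∀ b, ¬ FiniteDimensional ℂ (LinearMap.range (P b).toLinearMap)

namespace IsProjectionField

variable {P : B → H →L[ℂ] H}

theorem norm_apply_le (hP : IsProjectionField P) (b : B) (x : H) : ‖P b x‖ ≤ ‖x‖ := by
  have h1 : ‖P b x‖ * ‖P b x‖ ≤ ‖x‖ * ‖P b x‖ := by
    have h2 : inner ℂ (P b x) (P b x) = inner ℂ x (P b x) := by
      rw [hP.inner_apply, hP.apply_apply]
    have h3 := norm_inner_le_norm (𝕜 := ℂ) x (P b x)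
    rw [← h2, inner_self_eq_norm_sq_to_K] at h3
    simpa [sq] using h3
  rcases (norm_nonneg (P b x)).eq_or_lt with h | h
  · rw [← h]; exact norm_nonneg x
  · exact le_of_mul_le_mul_right h1 h

/-- Splitting off a unit section. -/
theorem sub_rankOne (hP : IsProjectionField P) {e : B → H} (he : Continuous e)
    (he1 : ∀ b, ‖e b‖ = 1) (hPe : ∀ b, P b (e b) = e b) :
    IsProjectionField fun b => P b - (innerSL ℂ (e b)).smulRight (e b) := by
  have hee : ∀ b, inner ℂ (e b) (e b) = 1 := fun b => by
    rw [inner_self_eq_norm_sq_to_K, he1]; simp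
  have heP : ∀ b x, inner ℂ (e b) (P b x) = inner ℂ (e b) x := fun b x => by
    rw [← hP.inner_apply, hPe]
  refine ⟨fun b x => ?_, fun b x y => ?_, fun x => ?_, fun b hfin => hP.infinite b ?_⟩
  · simp [inner_sub_right, inner_smul_right, hP.apply_apply, hPe, heP, he1]
  · simp [hP.inner_apply, mul_comm]
  · have h1 : Continuous fun b => inner ℂ (e b) x := he.inner continuous_const
    exact (hP.continuous_apply x).sub (h1.smul he)
  -- The old range lies in the new one plus a line, so the new range cannot be finite dimensional.
  · have : LinearMap.range (P b).toLinearMap ≤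
        LinearMap.range (P b - (innerSL ℂ (e b)).smulRight (e b)).toLinearMap ⊔
          Submodule.span ℂ {e b} := by
      rintro _ ⟨x, rfl⟩
      have : P b x = (P b - (innerSL ℂ (e b)).smulRight (e b)) x + inner ℂ (e b) x • e b := by
        simp
      change P b x ∈ _
      rw [this]
      exact Submodule.add_mem_sup ⟨x, rfl⟩
        (Submodule.smul_mem _ _ (Submodule.mem_span_singleton_self _))
    exact Submodule.finiteDimensional_of_le this

end IsProjectionField

/-- A perturbation of `s` along the `v i` that does not vanish where the `v i` are orthonormal. -/
theorem CoveringDimLE.exists_perturbation [T2Space B] [ParacompactSpace B] {N : ℕ}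
    (hB : CoveringDimLE B N) {v : Fin (N + 1) → B → H} (hv : ∀ i, Continuous (v i))
    (hv1 : ∀ i b, ‖v i b‖ ≤ 1) {s : B → H} (hs : Continuous s)
    {δ : B → ℝ} (hδ : Continuous δ) (hδ0 : ∀ b, 0 < δ b) :
    ∃ a : Fin (N + 1) → B → ℂ, (∀ i, Continuous (a i)) ∧
      (∀ b, ‖∑ i, a i b • v i b‖ ≤ δ b) ∧
      ∀ b, Orthonormal ℂ (fun i => v i b) → s b + ∑ i, a i b • v i b ≠ 0 := by
  let c : B → Fin (N + 1) → ℂ := fun b i => inner ℂ (v i b) (s b)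
  have hc : Continuous c := continuous_pi fun i => (hv i).inner hs
  obtain ⟨y, hy, hy0, hyc⟩ := hB.exists_nonvanishing_near (F := Fin (N + 1) → ℂ) (by simp) hc
    (hδ.div_const ((N : ℝ) + 1)) (fun b => div_pos (hδ0 b) (by positivity))
  refine ⟨fun i b => y b i - c b i, fun i => ?_, fun b => ?_, fun b ho h0 => ?_⟩
  · exact ((continuous_apply i).comp hy).sub ((continuous_apply i).comp hc)
  · calc ‖∑ i, (y b i - c b i) • v i b‖ ≤ ∑ i : Fin (N + 1), δ b / (N + 1) := by
          refine norm_sum_le_of_le _ fun i _ => ?_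
          rw [norm_smul]
          calc ‖y b i - c b i‖ * ‖v i b‖ ≤ ‖y b i - c b i‖ * 1 := by gcongr; exact hv1 i b
            _ ≤ ‖y b - c b‖ := by rw [mul_one]; exact norm_le_pi_norm (y b - c b) i
            _ ≤ δ b / (N + 1) := (hyc b).le
      _ = δ b := by
          rw [Finset.sum_const, Finset.card_univ, Fintype.card_fin, nsmul_eq_mul]
          push_cast
          field_simp
  · refine hy0 b (funext fun i => ?_)
    -- The perturbation replaces the frame coordinates `c b` of `s b` by the nonzero vector `y b`.
    have h1 : inner ℂ (v i b) (s b + ∑ j, (y b j - c b j) • v j b) = y b i := by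
      rw [inner_add_right, ho.inner_right_fintype (fun j => y b j - c b j) i]
      simp [c]
    rw [← h1, h0, inner_zero_right]; rfl

/-- Independence of the images is an open condition on tuples, nonempty by infinite rank, hence met
by a tuple from the dense sequence. This lets countably many open sets, one per index tuple, carry
all the local frames. -/
theorem exists_linearIndependent_apply_denseSeq {T : H →L[ℂ] H}
    (hT : ¬ FiniteDimensional ℂ (LinearMap.range T.toLinearMap)) {d : ℕ → H} (hd : DenseRange d)
    (m : ℕ) : ∃ n : Fin m → ℕ, LinearIndependent ℂ fun i => T (d (n i)) := by
  have hrank : (m : Cardinal) ≤ Module.rank ℂ (LinearMap.range T.toLinearMap) :=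
    (Cardinal.natCast_le_aleph0).trans
      (not_lt.1 fun h => hT (Module.rank_lt_aleph0_iff.1 h))
  obtain ⟨w, hw⟩ := Module.le_rank_iff_exists_linearMap.1 hrank
  have hb := (Pi.basisFun ℂ (Fin m)).linearIndependent.map' w (LinearMap.ker_eq_bot.2 hw)
  have hb' := hb.map' (LinearMap.range T.toLinearMap).subtype (Submodule.ker_subtype _)
  choose x hx using fun i => (w (Pi.basisFun ℂ (Fin m) i)).2
  have ho : IsOpen {z : Fin m → H | LinearIndependent ℂ fun i => T (z i)} :=
    isOpen_setOfPred_linearIndependent.preimage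
      (continuous_pi fun i => T.continuous.comp (continuous_apply i))
  have hne : {z : Fin m → H | LinearIndependent ℂ fun i => T (z i)}.Nonempty := by
    refine ⟨x, ?_⟩
    have h : (fun i => T (x i)) = (LinearMap.range T.toLinearMap).subtype ∘ w ∘
        Pi.basisFun ℂ (Fin m) := funext hx
    change LinearIndependent ℂ fun i => T (x i)
    rwa [h]
  obtain ⟨n, hn⟩ := (DenseRange.piMap fun _ : Fin m => hd).exists_mem_open ho hne
  exact ⟨n, hn⟩

open InnerProductSpace in
theorem continuousOn_gramSchmidt {m : ℕ} {w : Fin m → B → H} {U : Set B}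
    (hw : ∀ i, ContinuousOn (w i) U) (hli : ∀ b ∈ U, LinearIndependent ℂ fun i => w i b)
    (i : Fin m) : ContinuousOn (fun b => gramSchmidt ℂ (fun j => w j b) i) U := by
  induction i using WellFoundedLT.induction with
  | _ i ih =>
    have h : (fun b => gramSchmidt ℂ (fun j => w j b) i) = fun b => w i b - ∑ j ∈ Finset.Iio i,
        (inner ℂ (gramSchmidt ℂ (fun j => w j b) j) (w i b) /
          (‖gramSchmidt ℂ (fun j => w j b) j‖ : ℂ) ^ 2) • gramSchmidt ℂ (fun j => w j b) j := by
      funext b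
      exact eq_sub_of_add_eq (gramSchmidt_def'' ℂ (fun j => w j b) i).symm
    rw [h]
    refine (hw i).sub (continuousOn_finsetSum _ fun j hj => ?_)
    have hj' := ih j (Finset.mem_Iio.1 hj)
    refine ContinuousOn.smul (ContinuousOn.div (hj'.inner (hw i)) ?_ fun b hb => ?_) hj'
    · exact (Complex.continuous_ofReal.comp_continuousOn hj'.norm).pow 2
    · simpa using gramSchmidt_ne_zero (𝕜 := ℂ) j (hli b hb)

open InnerProductSpace in
theorem continuousOn_gramSchmidtNormed {m : ℕ} {w : Fin m → B → H} {U : Set B}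
    (hw : ∀ i, ContinuousOn (w i) U) (hli : ∀ b ∈ U, LinearIndependent ℂ fun i => w i b)
    (i : Fin m) : ContinuousOn (fun b => gramSchmidtNormed ℂ (fun j => w j b) i) U := by
  have h := continuousOn_gramSchmidt hw hli i
  refine ContinuousOn.smul (ContinuousOn.inv₀ ?_ fun b hb => ?_) h
  · exact Complex.continuous_ofReal.comp_continuousOn h.norm
  · simpa using gramSchmidt_ne_zero (𝕜 := ℂ) i (hli b hb)

open InnerProductSpace in
theorem norm_gramSchmidtNormed_le {m : ℕ} (w : Fin m → H) (i : Fin m) :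
    ‖gramSchmidtNormed ℂ w i‖ ≤ 1 := by
  by_cases h : gramSchmidtNormed ℂ w i = 0
  · rw [h, norm_zero]; exact zero_le_one
  · exact (gramSchmidtNormed_unit_length' h).le

open InnerProductSpace in
/-- A projection field has a locally finite countable family of cut-off orthonormal frames. -/
theorem IsProjectionField.exists_frames [T2Space B] [ParacompactSpace B]
    [TopologicalSpace.SeparableSpace H] {P : B → H →L[ℂ] H} (hP : IsProjectionField P) (m : ℕ) :
    ∃ v : ℕ → Fin m → B → H, (∀ k i, Continuous (v k i)) ∧ (∀ k i b, P b (v k i b) = v k i b) ∧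
      (∀ k i b, ‖v k i b‖ ≤ 1) ∧
      (∀ b, ∃ K, ∀ᶠ b' in 𝓝 b, ∀ k, K ≤ k → ∀ i, v k i b' = 0) ∧
      ∀ b, ∃ k, Orthonormal ℂ fun i => v k i b := by
  obtain ⟨d, hd⟩ := TopologicalSpace.exists_dense_seq H
  obtain ⟨n, hn⟩ := exists_surjective_nat (Fin m → ℕ)
  let U : ℕ → Set B := fun k => {b | LinearIndependent ℂ fun i => P b (d (n k i))}
  have hU : ∀ k, IsOpen (U k) := fun k =>
    isOpen_setOfPred_linearIndependent.preimage
      (continuous_pi fun i => hP.continuous_apply (d (n k i)))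
  -- A bump covering rather than a partition of unity: at each point some bump equals `1`, so the
  -- corresponding frame is not shrunk there.
  obtain ⟨θ, hθ⟩ := BumpCovering.exists_isSubordinate isClosed_univ U hU fun b _ => by
    obtain ⟨t, ht⟩ := exists_linearIndependent_apply_denseSeq (hP.infinite b) hd m
    obtain ⟨k, rfl⟩ := hn t
    exact Set.mem_iUnion.2 ⟨k, ht⟩
  let g : ℕ → Fin m → B → H := fun k i b =>
    gramSchmidtNormed ℂ (fun j => P b (d (n k j))) i
  have hg : ∀ k i, ContinuousOn (g k i) (U k) := fun k i =>
    continuousOn_gramSchmidtNormed (w := fun j b => P b (d (n k j)))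
      (fun j => (hP.continuous_apply _).continuousOn) (fun b hb => hb) i
  refine ⟨fun k i b => ((θ k b : ℝ) : ℂ) • g k i b, fun k i => ?_, fun k i b => ?_, fun k i b => ?_,
    fun b => ?_, fun b => ?_⟩
  · have hθc : Continuous fun b => ((θ k b : ℝ) : ℂ) :=
      Complex.continuous_ofReal.comp (θ k).continuous
    -- The Gram–Schmidt frame is only known to be continuous on `U k`, which contains the closed
    -- support of `θ k`.
    refine continuous_of_tsupport fun b hb => ?_
    have hb' : b ∈ tsupport (θ k) := by
      refine closure_mono (Function.support_subset_iff'.2 fun b' hb' => ?_) hb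
      beta_reduce
      rw [Function.notMem_support.1 hb', Complex.ofReal_zero, zero_smul]
    exact hθc.continuousAt.smul ((hg k i).continuousAt ((hU k).mem_nhds (hθ k hb')))
  · have h1 : g k i b ∈ LinearMap.range (P b).toLinearMap := by
      have h2 := gramSchmidt_mem_span ℂ (fun j => P b (d (n k j))) (le_refl i)
      refine Submodule.smul_mem _ _ (Submodule.span_le.2 ?_ h2)
      rintro _ ⟨j, -, rfl⟩
      exact ⟨_, rfl⟩
    obtain ⟨x, hx⟩ := h1
    have hx' : P b x = g k i b := hx
    beta_reduce
    rw [map_smul, ← hx', hP.apply_apply]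
  · rw [norm_smul, Complex.norm_real, Real.norm_of_nonneg (θ.nonneg k b)]
    exact mul_le_one₀ (θ.le_one k b) (norm_nonneg _) (norm_gramSchmidtNormed_le _ i)
  · obtain ⟨V, hV, hfin⟩ := θ.locallyFinite b
    obtain ⟨K, hK⟩ := hfin.bddAbove
    refine ⟨K + 1, Filter.mem_of_superset hV fun b' hb' k hk i => ?_⟩
    have : θ k b' = 0 := by
      by_contra h
      have := hK (show k ∈ _ from ⟨b', h, hb'⟩)
      omega
    simp [this]
  · have h1 := θ.ind_apply b (Set.mem_univ b)
    refine ⟨θ.ind b (Set.mem_univ b), ?_⟩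
    have hb : b ∈ U (θ.ind b (Set.mem_univ b)) :=
      hθ _ (subset_tsupport _ (by rw [Function.mem_support, h1]; exact one_ne_zero))
    simpa [h1] using gramSchmidtNormed_orthonormal hb

/-- With `h` a Urysohn function, `0` on `A` and `1` on the zeros of `s`, take `(‖s‖ + h) / 2` capped
at `ε`. A perturbation of size at most `δ` cannot create zeros on `A`. -/
theorem exists_continuous_pos_lt_norm {X : Type*} [NormedAddCommGroup X] [NormalSpace B] {A : Set B}
    (hA : IsClosed A) {s : B → X} (hs : Continuous s) (hs0 : ∀ b ∈ A, s b ≠ 0) {ε : ℝ} (hε : 0 < ε) :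
    ∃ δ : B → ℝ, Continuous δ ∧ (∀ b, 0 < δ b) ∧ (∀ b, δ b ≤ ε) ∧ ∀ b ∈ A, δ b < ‖s b‖ := by
  obtain ⟨h, h0, h1, h2⟩ := exists_continuous_zero_one_of_isClosed hA
    (isClosed_eq hs continuous_const : IsClosed {b | s b = 0})
    (Set.disjoint_left.2 fun b hb => hs0 b hb)
  refine ⟨fun b => min ε ((‖s b‖ + h b) / 2), ?_, fun b => ?_, fun b => min_le_left _ _,
    fun b hb => ?_⟩
  · exact continuous_const.min ((hs.norm.add h.continuous).div_const 2)
  · refine lt_min hε (half_pos ?_)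
    by_cases hb : s b = 0
    · have : h b = 1 := h1 hb
      rw [hb, this]; simp
    · exact add_pos_of_pos_of_nonneg (norm_pos_iff.2 hb) (h2 b).1
  · have : h b = 0 := h0 hb
    refine (min_le_right _ _).trans_lt ?_
    rw [this, add_zero]
    exact half_lt_self (norm_pos_iff.2 (hs0 b hb))

theorem isClosed_setOf_orthonormal {ι : Type*} {v : ι → B → H} (hv : ∀ i, Continuous (v i)) :
    IsClosed {b | Orthonormal ℂ fun i => v i b} := by
  classical
  simp only [orthonormal_iff_ite, Set.ofPred_forall]
  exact isClosed_iInter fun i => isClosed_iInter fun j =>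
    isClosed_eq ((hv i).inner (hv j)) continuous_const

/-- Every section of a projection field over a finite-dimensional paracompact space is close to a
nowhere vanishing one. -/
theorem IsProjectionField.exists_nonvanishing_section [T2Space B] [ParacompactSpace B]
    [TopologicalSpace.SeparableSpace H] {N : ℕ} (hB : CoveringDimLE B N) {P : B → H →L[ℂ] H}
    (hP : IsProjectionField P) {s : B → H} (hs : Continuous s) (hPs : ∀ b, P b (s b) = s b)
    {ε : ℝ} (hε : 0 < ε) :
    ∃ t : B → H, Continuous t ∧ (∀ b, P b (t b) = t b) ∧ (∀ b, t b ≠ 0) ∧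
      ∀ b, ‖t b - s b‖ ≤ ε := by
  obtain ⟨v, hv, hPv, hv1, hvf, hvo⟩ := hP.exists_frames (N + 1)
  -- Stage `k`: sections that are nonzero wherever one of the first `k` frames is orthonormal.
  let T : ℕ → Type _ := fun k => {t : B → H // Continuous t ∧ (∀ b, P b (t b) = t b) ∧
    ∀ j < k, ∀ b, Orthonormal ℂ (fun i => v j i b) → t b ≠ 0}
  have step : ∀ k (t : T k), ∃ t' : T (k + 1), (∀ b, ‖t'.1 b - t.1 b‖ ≤ ε / 2 / 2 ^ k) ∧
      ∀ b, (∀ i, v k i b = 0) → t'.1 b = t.1 b := by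
    rintro k ⟨t, ht, hPt, ht0⟩
    let A : Set B := ⋃ j ∈ Finset.range k, {b | Orthonormal ℂ fun i => v j i b}
    have hA : IsClosed A := isClosed_biUnion_finset fun j _ => isClosed_setOf_orthonormal (hv j)
    obtain ⟨δ, hδ, hδ0, hδε, hδA⟩ := exists_continuous_pos_lt_norm hA ht (fun b hb => by
      obtain ⟨j, hj, hb⟩ := Set.mem_iUnion₂.1 hb
      exact ht0 j (Finset.mem_range.1 hj) b hb) (ε := ε / 2 / 2 ^ k) (by positivity)
    obtain ⟨a, ha, haδ, ha0⟩ := hB.exists_perturbation (hv k) (hv1 k) ht hδ hδ0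
    refine ⟨⟨fun b => t b + ∑ i, a i b • v k i b, ?_, fun b => ?_, fun j hj b hb => ?_⟩,
      fun b => ?_, fun b hb => ?_⟩
    · exact ht.add (continuous_finsetSum _ fun i _ => (ha i).smul (hv k i))
    · simp only [map_add, map_sum, map_smul, hPt, hPv]
    · rcases Nat.lt_succ_iff_lt_or_eq.1 hj with h | rfl
      · intro h0
        have h1 := hδA b (Set.mem_iUnion₂.2 ⟨j, Finset.mem_range.2 h, hb⟩)
        rw [eq_neg_of_add_eq_zero_left h0, norm_neg] at h1
        exact absurd (haδ b) (not_le.2 h1)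
      · exact ha0 b hb
    · simpa using (haδ b).trans (hδε b)
    · simp [hb]
  choose next hnext hnext0 using step
  let u : ∀ k, T k := fun k => Nat.rec ⟨s, hs, hPs, fun j hj => absurd hj (Nat.not_lt_zero j)⟩ next k
  have hu : ∀ k, u (k + 1) = next k (u k) := fun k => rfl
  have hε' : ∀ k b, ‖(u k).1 b - s b‖ ≤ ε := by
    intro k b
    -- Partial sums of the geometric series of step sizes `ε / 2 / 2 ^ k`.
    have h : ∀ k, ‖(u k).1 b - s b‖ ≤ ε * (1 - 1 / 2 ^ k) := by
      intro k
      induction k with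
      | zero => simp [u]
      | succ k ih =>
        have h1 := hnext k (u k) b
        rw [← hu] at h1
        calc ‖(u (k + 1)).1 b - s b‖ ≤ ‖(u (k + 1)).1 b - (u k).1 b‖ + ‖(u k).1 b - s b‖ :=
              norm_sub_le_norm_sub_add_norm_sub _ _ _
          _ ≤ ε / 2 / 2 ^ k + ε * (1 - 1 / 2 ^ k) := add_le_add h1 ih
          _ = ε * (1 - 1 / 2 ^ (k + 1)) := by rw [pow_succ]; field_simp; ring
    refine (h k).trans (mul_le_of_le_one_right hε.le ?_)
    have : (0 : ℝ) < 1 / 2 ^ k := by positivity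
    linarith
  choose K hK using hvf
  have hstab : ∀ b, ∀ᶠ b' in 𝓝 b, ∀ k, K b ≤ k → (u k).1 b' = (u (K b)).1 b' := fun b => by
    filter_upwards [hK b] with b' hb' k hk
    induction k, hk using Nat.le_induction with
    | base => rfl
    | succ k hk ih => rw [hu, hnext0 k _ b' (hb' k hk), ih]
  -- Near `b` all frames from `K b` on vanish, so the stages are eventually constant there and `t`
  -- is their locally stationary limit.
  let t : B → H := fun b => (u (K b)).1 b
  have ht : ∀ b k, K b ≤ k → t b = (u k).1 b := fun b k hk => ((hstab b).self_of_nhds k hk).symm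
  refine ⟨t, ?_, fun b => (u (K b)).2.2.1 b, fun b => ?_, fun b => hε' (K b) b⟩
  · rw [continuous_iff_continuousAt]
    intro b
    refine ((u (K b)).2.1.continuousAt (x := b)).congr ?_
    filter_upwards [hstab b] with b' hb'
    rw [ht b' (max (K b) (K b')) (le_max_right _ _), hb' _ (le_max_left _ _)]
  · obtain ⟨j, hj⟩ := hvo b
    rw [ht b (max (K b) (j + 1)) (le_max_left _ _)]
    exact (u _).2.2.2 j (lt_of_lt_of_le (Nat.lt_succ_self j) (le_max_right _ _)) b hj

/-- One step of the construction of a continuous orthonormal basis. -/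
theorem IsProjectionField.exists_unit_section [T2Space B] [ParacompactSpace B]
    [TopologicalSpace.SeparableSpace H] {N : ℕ} (hB : CoveringDimLE B N) {P : B → H →L[ℂ] H}
    (hP : IsProjectionField P) (x : H) {ε : ℝ} (hε : 0 < ε) :
    ∃ e : B → H, Continuous e ∧ (∀ b, ‖e b‖ = 1) ∧ (∀ b, P b (e b) = e b) ∧
      ∀ b, ‖(P b - (innerSL ℂ (e b)).smulRight (e b)) x‖ ≤ ε := by
  obtain ⟨t, ht, hPt, ht0, hts⟩ := hP.exists_nonvanishing_section hB (hP.continuous_apply x)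
    (fun b => hP.apply_apply b x) hε
  have htn : Continuous fun b => ((‖t b‖ : ℂ))⁻¹ :=
    (Complex.continuous_ofReal.comp ht.norm).inv₀ fun b => by simpa using ht0 b
  have he : Continuous fun b => ((‖t b‖ : ℂ))⁻¹ • t b := htn.smul ht
  have he1 : ∀ b, ‖((‖t b‖ : ℂ))⁻¹ • t b‖ = 1 := fun b => norm_smul_inv_norm (ht0 b)
  have hPe : ∀ b, P b (((‖t b‖ : ℂ))⁻¹ • t b) = ((‖t b‖ : ℂ))⁻¹ • t b := fun b => by
    rw [map_smul, hPt]
  refine ⟨_, he, he1, hPe, fun b => ?_⟩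
  have hQ := hP.sub_rankOne he he1 hPe
  set e : B → H := fun b => ((‖t b‖ : ℂ))⁻¹ • t b with hedef
  set Q : B → H →L[ℂ] H := fun b => P b - (innerSL ℂ (e b)).smulRight (e b) with hQdef
  have hQe : Q b (e b) = 0 := by
    have h1 : P b (e b) = e b := hPe b
    have h2 : ‖e b‖ = 1 := he1 b
    simp [hQdef, h1, h2]
  have hQt : Q b (t b) = 0 := by
    have : t b = (‖t b‖ : ℂ) • e b := by
      rw [hedef, smul_inv_smul₀ (by simpa using ht0 b)]
    rw [this, map_smul, hQe, smul_zero]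
  have hQP : Q b (P b x) = Q b x := by
    have h1 : inner ℂ (e b) (P b x) = inner ℂ (e b) x := by rw [← hP.inner_apply, hPe b]
    simp only [hQdef, sub_apply, ContinuousLinearMap.smulRight_apply,
      innerSL_apply_apply, hP.apply_apply, h1]
  -- `Q b` kills `t b`, which is within `ε` of `P b x`.
  calc ‖Q b x‖ = ‖Q b (t b - P b x)‖ := by rw [map_sub, hQt, hQP, zero_sub, norm_neg]
    _ ≤ ‖t b - P b x‖ := hQ.norm_apply_le b _
    _ ≤ ε := hts b

/-- **Dixmier–Douady**: over a finite-dimensional paracompact space, the ranges of a strongly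
continuous family of projections of infinite rank have orthonormal bases that vary continuously. -/
theorem IsProjectionField.exists_orthonormal_basis [T2Space B] [ParacompactSpace B]
    [TopologicalSpace.SeparableSpace H] (hB : FiniteCoveringDim B) {P : B → H →L[ℂ] H}
    (hP : IsProjectionField P) :
    ∃ e : ℕ → B → H, (∀ n, Continuous (e n)) ∧ (∀ n b, P b (e n b) = e n b) ∧
      (∀ b, Orthonormal ℂ fun n => e n b) ∧
      ∀ b x, P b x = x → (∀ n, inner ℂ (e n b) x = 0) → x = 0 := by
  obtain ⟨N, hN⟩ := hB
  obtain ⟨d, hd⟩ := TopologicalSpace.exists_dense_seq H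
  choose g hg hg1 hPg hgε using fun (n : ℕ) (Q : {Q : B → H →L[ℂ] H // IsProjectionField Q}) =>
    Q.2.exists_unit_section hN (d n.unpair.1) (Nat.one_div_pos_of_nat (α := ℝ) (n := n))
  -- `Q n` is what remains of `P` after splitting off `e 0, …, e (n - 1)`.
  let Q : ℕ → {Q : B → H →L[ℂ] H // IsProjectionField Q} := fun n =>
    Nat.rec ⟨P, hP⟩ (fun n Q => ⟨_, Q.2.sub_rankOne (hg n Q) (hg1 n Q) (hPg n Q)⟩) n
  let e : ℕ → B → H := fun n => g n (Q n)
  have hQ : ∀ n b x, (Q (n + 1)).1 b x = (Q n).1 b x - inner ℂ (e n b) x • e n b :=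
    fun n b x => rfl
  have hee : ∀ n b, inner ℂ (e n b) (e n b) = 1 := fun n b => by
    rw [inner_self_eq_norm_sq_to_K, hg1]; simp
  have hQe : ∀ n b, (Q (n + 1)).1 b (e n b) = 0 := fun n b => by
    rw [hQ, hee, hPg, one_smul, sub_self]
  have hfix : ∀ n b x, (Q (n + 1)).1 b x = x → inner ℂ (e n b) x = 0 ∧ (Q n).1 b x = x := by
    intro n b x hx
    have h1 : inner ℂ (e n b) x = 0 := by
      rw [← hx, ← (Q (n + 1)).2.inner_apply, hQe, inner_zero_left]
    refine ⟨h1, ?_⟩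
    have := hQ n b x
    rwa [h1, zero_smul, sub_zero, hx, eq_comm] at this
  have hfix' : ∀ n k b x, (Q (n + k)).1 b x = x → (Q n).1 b x = x := by
    intro n k b x
    induction k with
    | zero => exact id
    | succ k ih => exact fun h => ih (hfix _ b x h).2
  have horth : ∀ b n m, n < m → inner ℂ (e n b) (e m b) = 0 := by
    intro b n m h
    obtain ⟨k, rfl⟩ := Nat.exists_eq_add_of_lt h
    refine (hfix n b _ (hfix' (n + 1) k b _ ?_)).1
    rw [show n + 1 + k = n + k + 1 by ring]
    exact hPg _ _ _
  refine ⟨e, fun n => hg _ _, fun n b => ?_, fun b => ⟨fun n => hg1 _ _ _, fun n m h => ?_⟩,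
    fun b x hx h0 => ?_⟩
  · have := hfix' 0 n b (e n b)
    rw [zero_add] at this
    exact this (hPg _ _ _)
  · rcases lt_or_gt_of_ne h with h | h
    · exact horth b n m h
    · exact inner_eq_zero_symm.1 (horth b m n h)
  · have hQx : ∀ n, (Q n).1 b x = x := by
      intro n
      induction n with
      | zero => exact hx
      | succ n ih => rw [hQ, h0, zero_smul, sub_zero, ih]
    by_contra hx0
    have hpos : 0 < ‖x‖ / 2 := half_pos (norm_pos_iff.2 hx0)
    obtain ⟨k, hk⟩ := Metric.denseRange_iff.1 hd x _ hpos
    -- Every `Q n` fixes `x`, but at `n = Nat.pair k l` the next remainder is small on `d k`, which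
    -- is close to `x`; this forces `‖x‖ < ‖x‖`.
    obtain ⟨l, hl⟩ := exists_nat_one_div_lt hpos
    set n := Nat.pair k l with hn
    have h1 : ‖(Q (n + 1)).1 b (d k)‖ ≤ 1 / ((n : ℝ) + 1) := by
      have := hgε n (Q n) b
      rw [hn, Nat.unpair_pair] at this
      exact this
    have h2 : (1 : ℝ) / ((n : ℝ) + 1) ≤ 1 / (l + 1) :=
      Nat.one_div_le_one_div (Nat.right_le_pair k l)
    have h3 : ‖x‖ ≤ ‖(Q (n + 1)).1 b (x - d k)‖ + ‖(Q (n + 1)).1 b (d k)‖ := by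
      refine le_trans (le_of_eq ?_) (norm_add_le _ _)
      rw [← map_add, sub_add_cancel, hQx (n + 1)]
    have h4 := (Q (n + 1)).2.norm_apply_le b (x - d k)
    rw [dist_eq_norm] at hk
    linarith

end ProjectionField

/-! ### Weight spaces of unitary representations of compact abelian groups -/

section WeightSpaces

open MeasureTheory

variable {K : Type*} [CommGroup K] [TopologicalSpace K]
variable {H : Type*} [NormedAddCommGroup H] [InnerProductSpace ℂ H] [CompleteSpace H]

theorem UnitaryGroup.inner_map_map (U : UnitaryGroup H) (x y : H) :
    inner ℂ (U.toCLM x) (U.toCLM y) = inner ℂ x y :=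
  U.toCLM.inner_map_map_of_mem_unitary U.2 x y

theorem UnitaryGroup.norm_map (U : UnitaryGroup H) (x : H) : ‖U.toCLM x‖ = ‖x‖ :=
  Unitary.norm_map U x

theorem continuous_apply_vector (α : K →ₜ* UnitaryGroup H) (x : H) :
    Continuous fun k => (α k).toCLM x :=
  UnitaryGroup.continuous_iff.1 α.continuous_toFun x

theorem toCLM_map_mul (α : K →ₜ* UnitaryGroup H) (k l : K) (x : H) :
    (α (k * l)).toCLM x = (α k).toCLM ((α l).toCLM x) := by
  rw [map_mul, UnitaryGroup.toCLM_mul, mul_apply_eq_comp]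

theorem toCLM_map_inv_map (α : K →ₜ* UnitaryGroup H) (k : K) (x : H) :
    (α k⁻¹).toCLM ((α k).toCLM x) = x := by
  rw [← toCLM_map_mul, inv_mul_cancel, map_one, UnitaryGroup.toCLM_one,
    one_apply_eq_self]

theorem inner_map_left (α : K →ₜ* UnitaryGroup H) (k : K) (x y : H) :
    inner ℂ x ((α k).toCLM y) = inner ℂ ((α k⁻¹).toCLM x) y := by
  rw [← (α k⁻¹).inner_map_map x, toCLM_map_inv_map]

/-- The vectors on which `K` acts through the character `χ`. -/
def weightSpace (α : K →ₜ* UnitaryGroup H) (χ : K →ₜ* Circle) : Submodule ℂ H where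
  carrier := {x | ∀ k, (α k).toCLM x = (χ k : ℂ) • x}
  add_mem' hx hy k := by rw [map_add, hx, hy, smul_add]
  zero_mem' k := by simp
  smul_mem' c x hx k := by rw [map_smul, hx, smul_comm]

theorem mem_weightSpace {α : K →ₜ* UnitaryGroup H} {χ : K →ₜ* Circle} {x : H} :
    x ∈ weightSpace α χ ↔ ∀ k, (α k).toCLM x = (χ k : ℂ) • x := Iff.rfl

theorem isClosed_weightSpace (α : K →ₜ* UnitaryGroup H) (χ : K →ₜ* Circle) :
    IsClosed (weightSpace α χ : Set H) := by
  have : (weightSpace α χ : Set H) = ⋂ k, {x | (α k).toCLM x = (χ k : ℂ) • x} := by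
    ext x; simp [mem_weightSpace]
  rw [this]
  exact isClosed_iInter fun k => isClosed_eq (α k).toCLM.continuous (continuous_const_smul _)

instance (α : K →ₜ* UnitaryGroup H) (χ : K →ₜ* Circle) :
    CompleteSpace (weightSpace α χ) :=
  (isClosed_weightSpace α χ).completeSpace_coe

theorem inner_eq_zero_of_mem_weightSpace {α : K →ₜ* UnitaryGroup H} {χ ψ : K →ₜ* Circle}
    (h : χ ≠ ψ) {x y : H} (hx : x ∈ weightSpace α χ) (hy : y ∈ weightSpace α ψ) :
    inner ℂ x y = 0 := by
  by_contra h0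
  refine h (ContinuousMonoidHom.ext fun k => ?_)
  have h1 := (α k).inner_map_map x y
  rw [hx k, hy k, inner_smul_left, inner_smul_right, ← mul_assoc] at h1
  have h2 := mul_right_cancel₀ h0 (h1.trans (one_mul _).symm)
  rw [← Circle.coe_inv_eq_conj] at h2
  have h3 : (χ k)⁻¹ * ψ k = 1 := Circle.ext (by simpa using h2)
  exact inv_mul_eq_one.1 h3

/-- The one-dimensional representation given by a character. -/
def characterRep (χ : K →ₜ* Circle) : Representation ℂ K (Fin 1 → ℂ) where
  toFun k := (χ k : ℂ) • LinearMap.id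
  map_one' := by ext; simp
  map_mul' k l := by ext; simp [mul_assoc, mul_left_comm]

theorem characterRep_isIrreducible (χ : K →ₜ* Circle) : (characterRep χ).IsIrreducible where
  exists_pair_ne := ⟨⊥, ⊤, fun h => by
    have h1 : (fun _ => 1 : Fin 1 → ℂ) ∈ (⊥ : Subrepresentation (characterRep χ)) := by
      rw [h]; trivial
    have h2 : (fun _ => 1 : Fin 1 → ℂ) = 0 := h1
    exact one_ne_zero (congrFun h2 0)⟩
  eq_bot_or_eq_top S := by
    have : IsSimpleModule ℂ (Fin 1 → ℂ) := isSimpleModule_iff_finrank_eq_one.2 (by simp)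
    rcases eq_bot_or_eq_top S.toSubmodule with h | h
    · exact Or.inl (Subrepresentation.toSubmodule_injective h)
    · exact Or.inr (Subrepresentation.toSubmodule_injective h)

/-- The irreducible representation given by a character. -/
def characterIrrep (χ : K →ₜ* Circle) : IrrepModel K where
  dim := 1
  rep := characterRep χ
  irreducible := characterRep_isIrreducible χ
  continuous_rep := by
    have h : Continuous fun p : K × (Fin 1 → ℂ) => (χ p.1 : ℂ) • p.2 :=
      (continuous_subtype_val.comp (χ.continuous_toFun.comp continuous_fst)).smul continuous_snd
    exact h

theorem isotypicModel_characterIrrep (α : K →ₜ* UnitaryGroup H) (χ : K →ₜ* Circle) :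
    isotypicModel α (characterIrrep χ) = weightSpace α χ := by
  apply le_antisymm
  · refine iSup_le fun f => ?_
    rintro _ ⟨v, rfl⟩ k
    have h := LinearMap.congr_fun (f.isIntertwining' k) v
    have h1 : f.toLinearMap ((χ k : ℂ) • v) = (α k).toCLM (f.toLinearMap v) := h
    rw [← h1, map_smul]
  · intro x hx
    let f : (characterIrrep χ).rep.IntertwiningMap (toRep α) :=
      { toLinearMap := ((LinearMap.toSpanSingleton ℂ H x).comp (LinearMap.proj (0 : Fin 1)) :
          (Fin 1 → ℂ) →ₗ[ℂ] H)
        isIntertwining' := fun k => by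
          refine LinearMap.ext fun v => ?_
          change ((χ k : ℂ) * v (0 : Fin 1)) • x = (α k).toCLM (v (0 : Fin 1) • x)
          rw [map_smul, hx k, smul_smul, mul_comm] }
    refine Submodule.mem_iSup_of_mem f ⟨fun _ => 1, ?_⟩
    change (1 : ℂ) • x = x
    exact one_smul ℂ x

/-- A finite-dimensional invariant subspace contains a weight vector. -/
theorem exists_mem_weightSpace_of_finiteDimensional (α : K →ₜ* UnitaryGroup H)
    (W : Submodule ℂ H) [FiniteDimensional ℂ W] (hW : W ≠ ⊥)
    (hinv : ∀ k, ∀ x ∈ W, (α k).toCLM x ∈ W) :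
    ∃ χ : K →ₜ* Circle, ∃ x ∈ W, x ≠ 0 ∧ x ∈ weightSpace α χ := by
  suffices h : ∃ x ∈ W, x ≠ 0 ∧ ∀ k, ∃ c : ℂ, (α k).toCLM x = c • x by
    obtain ⟨x, hxW, hx0, hx⟩ := h
    choose c hc using hx
    have hnorm : ∀ k, ‖c k‖ = 1 := fun k => by
      have h1 := (α k).norm_map x
      rw [hc, norm_smul] at h1
      exact mul_right_cancel₀ (norm_ne_zero_iff.2 hx0) (h1.trans (one_mul _).symm)
    have hcont : Continuous c := by
      have h1 : c = fun k => inner ℂ x ((α k).toCLM x) / inner ℂ x x := by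
        funext k
        rw [hc, inner_smul_right, mul_div_cancel_right₀ _ (inner_self_ne_zero.2 hx0)]
      rw [h1]
      exact (continuous_const.inner (continuous_apply_vector α x)).div_const _
    have hmul : ∀ k l, c (k * l) = c k * c l := fun k l => by
      have h1 := toCLM_map_mul α k l x
      rw [hc, hc, map_smul, hc, smul_smul, mul_comm (c l)] at h1
      exact smul_left_injective ℂ hx0 h1
    have hone : c 1 = 1 := by
      have h1 := hmul 1 1
      rw [mul_one] at h1
      exact (mul_eq_left₀ (norm_ne_zero_iff.1 (by rw [hnorm]; exact one_ne_zero))).1 h1.symm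
    let χ : K →ₜ* Circle :=
      { toFun := fun k => ⟨c k, mem_sphere_zero_iff_norm.2 (hnorm k)⟩
        map_one' := Circle.ext hone
        map_mul' := fun k l => Circle.ext (hmul k l)
        continuous_toFun := Continuous.subtype_mk hcont _ }
    exact ⟨χ, x, hxW, hx0, hc⟩
  obtain ⟨n, hn⟩ : ∃ n, Module.finrank ℂ W = n := ⟨_, rfl⟩
  induction n using Nat.strong_induction_on generalizing W with
  | _ n ih =>
    -- If some `α k` is not scalar on `W`, one of its eigenspaces in `W` is proper and nonzero, and
    -- it is invariant because `K` is commutative; induct on dimension.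
    by_cases hs : ∀ k, ∃ c : ℂ, ∀ x ∈ W, (α k).toCLM x = c • x
    · obtain ⟨x, hx, hx0⟩ := W.exists_mem_ne_zero_of_ne_bot hW
      exact ⟨x, hx, hx0, fun k => (hs k).imp fun c hc => hc x hx⟩
    · push Not at hs
      obtain ⟨k, hk⟩ := hs
      have : Nontrivial W := Submodule.nontrivial_iff_ne_bot.2 hW
      obtain ⟨c, hc⟩ := Module.End.exists_eigenvalue
        ((α k).toCLM.toLinearMap.restrict (hinv k))
      obtain ⟨⟨w, hwW⟩, hw⟩ := hc.exists_hasEigenvector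
      let W' : Submodule ℂ H := W ⊓ Module.End.eigenspace (α k).toCLM.toLinearMap c
      have hle : W' ≤ W := inf_le_left
      have : FiniteDimensional ℂ W' := Submodule.finiteDimensional_of_le hle
      have hlt : W' < W := by
        refine lt_of_le_of_ne hle fun h => ?_
        obtain ⟨x, hx, hxc⟩ := hk c
        rw [← h] at hx
        exact hxc (Module.End.mem_eigenspace_iff.1 hx.2)
      have hne : W' ≠ ⊥ := by
        refine (Submodule.ne_bot_iff _).2 ⟨w, ⟨hwW, ?_⟩, fun h => hw.2 (Subtype.ext h)⟩
        refine Module.End.mem_eigenspace_iff.2 ?_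
        exact congrArg Subtype.val hw.apply_eq_smul
      obtain ⟨x, hx, hx'⟩ := ih _ (hn ▸ Submodule.finrank_lt_finrank_of_lt hlt) W' hne
        (fun l x hx => ⟨hinv l x hx.1, by
          refine Module.End.mem_eigenspace_iff.2 ?_
          have h1 : (α k).toCLM x = c • x := Module.End.mem_eigenspace_iff.1 hx.2
          change (α k).toCLM ((α l).toCLM x) = c • (α l).toCLM x
          rw [← toCLM_map_mul, mul_comm, toCLM_map_mul, h1, map_smul]⟩) rfl
      exact ⟨x, hle hx, hx'⟩

theorem integrable_of_continuous {K : Type*} [TopologicalSpace K] [CompactSpace K]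
    [MeasurableSpace K] [BorelSpace K] {X : Type*} [NormedAddCommGroup X] (μ : Measure K)
    [IsFiniteMeasureOnCompacts μ] {g : K → X} (hg : Continuous g) : Integrable g μ :=
  hg.integrable_of_hasCompactSupport (HasCompactSupport.of_compactSpace g)

/-- Although `α` is only strongly continuous, these rank-one operators vary norm-continuously, so
their average is a Bochner integral in operator norm and limits stay compact. -/
theorem continuous_rankOne_apply (α : K →ₜ* UnitaryGroup H) (x : H) :
    Continuous fun k => InnerProductSpace.rankOne ℂ ((α k).toCLM x) ((α k).toCLM x) := by
  have h := continuous_apply_vector α x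
  exact (ContinuousLinearMap.smulRightL ℂ H H).continuous₂.comp
    (((innerSL ℂ).continuous.comp h).prodMk h)

variable [CompactSpace K] [MeasurableSpace K] [BorelSpace K]

/-- The average over `K` of the projections onto the lines spanned by the `α k x`. -/
def averageRankOne (μ : Measure K) (α : K →ₜ* UnitaryGroup H) (x : H) : H →L[ℂ] H :=
  ∫ k, InnerProductSpace.rankOne ℂ ((α k).toCLM x) ((α k).toCLM x) ∂μ

section average

variable (μ : Measure K) [IsProbabilityMeasure μ] (α : K →ₜ* UnitaryGroup H) (x : H)

theorem averageRankOne_apply (y : H) : averageRankOne μ α x y =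
    ∫ k, inner ℂ ((α k).toCLM x) y • (α k).toCLM x ∂μ := by
  rw [averageRankOne, ContinuousLinearMap.integral_apply
    (integrable_of_continuous μ (continuous_rankOne_apply α x))]
  rfl

theorem isCompactOperator_averageRankOne : IsCompactOperator (averageRankOne μ α x) := by
  have hc : Convex ℝ {T : H →L[ℂ] H | IsCompactOperator T} := fun S hS T hT a b _ _ _ =>
    (hS.smul a).add (hT.smul b)
  refine hc.integral_mem isClosed_setOfPred_isCompactOperator (Filter.Eventually.of_forall
    fun k => ?_) (integrable_of_continuous μ (continuous_rankOne_apply α x))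
  have h : IsCompactOperator (ContinuousLinearMap.toSpanSingleton ℂ ((α k).toCLM x)) :=
    isCompactOperator_of_locallyCompactSpace_rng _
  exact h.comp_clm (innerSL ℂ ((α k).toCLM x))

theorem isSymmetric_averageRankOne : (averageRankOne μ α x).IsSymmetric := by
  have hcl : IsClosed {T : H →L[ℂ] H | T.IsSymmetric} := by
    have : {T : H →L[ℂ] H | T.IsSymmetric} =
        ⋂ y, ⋂ z, {T : H →L[ℂ] H | inner ℂ (T y) z = inner ℂ y (T z)} := by
      ext T; simp only [Set.mem_iInter]; rfl
    rw [this]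
    refine isClosed_iInter fun y => isClosed_iInter fun z => isClosed_eq ?_ ?_ <;> fun_prop
  have hc : Convex ℝ {T : H →L[ℂ] H | T.IsSymmetric} := fun S hS T hT a b _ _ _ y z => by
    have h1 : inner ℂ (S y) z = inner ℂ y (S z) := hS y z
    have h2 : inner ℂ (T y) z = inner ℂ y (T z) := hT y z
    change inner ℂ (a • S y + b • T y) z = inner ℂ y (a • S z + b • T z)
    simp only [inner_add_left, inner_add_right, inner_smul_left_eq_smul, inner_smul_right_eq_smul,
      h1, h2]
  refine hc.integral_mem hcl (Filter.Eventually.of_forall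
    fun k => ?_) (integrable_of_continuous μ (continuous_rankOne_apply α x))
  intro y z
  change inner ℂ (inner ℂ ((α k).toCLM x) y • (α k).toCLM x) z =
    inner ℂ y (inner ℂ ((α k).toCLM x) z • (α k).toCLM x)
  rw [inner_smul_left, inner_smul_right, inner_conj_symm, mul_comm]

/-- Substitute `l ↦ k * l` in the integral, using left invariance and unitarity. -/
theorem averageRankOne_map [IsTopologicalGroup K] [μ.IsMulLeftInvariant] (k : K) (y : H) :
    averageRankOne μ α x ((α k).toCLM y) = (α k).toCLM (averageRankOne μ α x y) := by
  have hi := integrable_of_continuous μ (show Continuous fun l =>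
      inner ℂ ((α l).toCLM x) y • (α l).toCLM x from
    ((continuous_apply_vector α x).inner continuous_const).smul (continuous_apply_vector α x))
  rw [averageRankOne_apply, averageRankOne_apply, ← ContinuousLinearMap.integral_comp_comm _ hi,
    ← integral_mul_left_eq_self _ k]
  refine integral_congr_ae (Filter.Eventually.of_forall fun l => ?_)
  simp only [toCLM_map_mul, UnitaryGroup.inner_map_map, map_smul]

theorem averageRankOne_mem {M : Submodule ℂ H} (hM : IsClosed (M : Set H))
    (hx : ∀ k, (α k).toCLM x ∈ M) (y : H) : averageRankOne μ α x y ∈ M := by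
  rw [averageRankOne_apply]
  refine (M.restrictScalars ℝ).convex.integral_mem hM (Filter.Eventually.of_forall
    fun k => M.smul_mem _ (hx k)) (integrable_of_continuous μ ?_)
  exact ((continuous_apply_vector α x).inner continuous_const).smul (continuous_apply_vector α x)

/-- `⟪x, T x⟫` is the integral of `|⟪α k x, x⟫|²`, a continuous nonnegative function that is
positive at `k = 1`. -/
theorem averageRankOne_ne_zero [μ.IsOpenPosMeasure] (hx : x ≠ 0) : averageRankOne μ α x ≠ 0 := by
  intro h0
  have hc : Continuous fun k => inner ℂ ((α k).toCLM x) x :=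
    (continuous_apply_vector α x).inner continuous_const
  have h1 : inner ℂ x (averageRankOne μ α x x) =
      ((∫ k, ‖inner ℂ ((α k).toCLM x) x‖ ^ 2 ∂μ : ℝ) : ℂ) := by
    rw [averageRankOne_apply, ← integral_inner (integrable_of_continuous μ
      (hc.fun_smul (continuous_apply_vector α x))), ← integral_complex_ofReal]
    refine integral_congr_ae (Filter.Eventually.of_forall fun k => ?_)
    simp only [inner_smul_right]
    rw [← inner_conj_symm x, RCLike.mul_conj]
    simp
  have h2 : 0 < ∫ k, ‖inner ℂ ((α k).toCLM x) x‖ ^ 2 ∂μ :=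
    (hc.norm.pow 2).integral_pos_of_hasCompactSupport_nonneg_nonzero
      (HasCompactSupport.of_compactSpace _) (fun k => by positivity) (x := 1) (by
        simp [UnitaryGroup.toCLM_one, hx])
  rw [h0, zero_apply, inner_zero_right] at h1
  exact h2.ne' (by exact_mod_cast h1.symm)

end average

variable [IsTopologicalGroup K]

/-- Weight vectors of a unitary representation of a compact abelian group are total. -/
theorem iSup_weightSpace_orthogonal (μ : Measure K) [IsProbabilityMeasure μ]
    [μ.IsMulLeftInvariant] [μ.IsOpenPosMeasure] (α : K →ₜ* UnitaryGroup H) :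
    (⨆ χ, weightSpace α χ)ᗮ = ⊥ := by
  rw [Submodule.eq_bot_iff]
  intro x hx
  by_contra hx0
  set M := (⨆ χ, weightSpace α χ)ᗮ with hM
  have hMmem : ∀ y, y ∈ M ↔ ∀ χ, ∀ w ∈ weightSpace α χ, inner ℂ w y = 0 := fun y => by
    rw [hM, ← Submodule.iInf_orthogonal, Submodule.mem_iInf]
    simp only [Submodule.mem_orthogonal]
  have hMinv : ∀ k, ∀ y ∈ M, (α k).toCLM y ∈ M := fun k y hy => by
    rw [hMmem] at hy ⊢
    intro χ w hw
    rw [inner_map_left, hw, inner_smul_left, hy χ w hw, mul_zero]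
  set T := averageRankOne μ α x with hT
  have hcomp := isCompactOperator_averageRankOne μ α x
  -- The spectral theorem gives the compact symmetric `T ≠ 0` a nonzero eigenvalue. Its eigenspace
  -- is finite dimensional, invariant and inside `M`, so `M` contains a weight vector orthogonal to
  -- itself.
  have hne : ¬ ∀ c, Module.End.HasEigenvalue (T : Module.End ℂ H) c → c = 0 := fun h =>
    averageRankOne_ne_zero μ α x hx0
      ((ContinuousLinearMap.eq_zero_of_forall_hasEigenvalue_eq_zero hcomp
        (isSymmetric_averageRankOne μ α x)).1 h)
  push Not at hne
  obtain ⟨c, hc, hc0⟩ := hne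
  have := ContinuousLinearMap.finite_dimensional_eigenspace hcomp c hc0
  obtain ⟨χ, w, hw, hw0, hwχ⟩ := exists_mem_weightSpace_of_finiteDimensional α
    (Module.End.eigenspace T.toLinearMap c) hc fun k y hy => by
      rw [Module.End.mem_eigenspace_iff] at hy ⊢
      have h1 : T y = c • y := hy
      change T ((α k).toCLM y) = c • (α k).toCLM y
      rw [hT, averageRankOne_map, ← hT, h1, map_smul]
  have hwM : w ∈ M := by
    have h1 : T w = c • w := Module.End.mem_eigenspace_iff.1 hw
    have h2 : w = c⁻¹ • T w := by rw [h1, inv_smul_smul₀ hc0]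
    rw [h2]
    exact M.smul_mem _ (averageRankOne_mem μ α x (Submodule.isClosed_orthogonal _)
      (fun k => hMinv k x hx) w)
  exact hw0 (inner_self_eq_zero.1 ((hMmem w).1 hwM χ w hwχ))

/-- Invariance of `μ` puts the integral in the weight space; against a weight vector `y` the
integrand pairs to the constant `⟪y, x⟫`, so the difference from `x` is orthogonal. -/
theorem starProjection_weightSpace_apply (μ : Measure K) [IsProbabilityMeasure μ]
    [μ.IsMulLeftInvariant] (α : K →ₜ* UnitaryGroup H) (χ : K →ₜ* Circle) (x : H) :
    (weightSpace α χ).starProjection x = ∫ k, ((χ k)⁻¹ : ℂ) • (α k).toCLM x ∂μ := by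
  have hχ : Continuous fun k => ((χ k)⁻¹ : ℂ) :=
    (continuous_subtype_val.comp χ.continuous_toFun).inv₀ fun k => Circle.coe_ne_zero _
  have hi := integrable_of_continuous μ (hχ.fun_smul (continuous_apply_vector α x))
  refine Submodule.eq_starProjection_of_mem_of_inner_eq_zero (fun h => ?_) fun y hy => ?_
  · rw [← ContinuousLinearMap.integral_comp_comm _ hi, ← integral_smul,
      ← integral_mul_left_eq_self (fun k => (χ h : ℂ) • ((χ k)⁻¹ : ℂ) • (α k).toCLM x) h]
    refine integral_congr_ae (Filter.Eventually.of_forall fun k => ?_)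
    simp only [map_smul, toCLM_map_mul, map_mul χ, Circle.coe_mul, smul_smul, mul_inv]
    rw [mul_inv_cancel_left₀ (Circle.coe_ne_zero _)]
  · have h1 : inner ℂ y (∫ k, ((χ k)⁻¹ : ℂ) • (α k).toCLM x ∂μ) = inner ℂ y x := by
      rw [← integral_inner hi]
      have : ∀ k, inner ℂ y (((χ k)⁻¹ : ℂ) • (α k).toCLM x) = inner ℂ y x := fun k => by
        rw [inner_smul_right, inner_map_left, hy, inner_smul_left, map_inv,
          Circle.coe_inv_eq_conj, Complex.conj_conj, inv_mul_cancel_left₀ (Circle.coe_ne_zero _)]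
      simp [this]
    rw [← inner_conj_symm, inner_sub_right, h1, sub_self, map_zero]

theorem continuous_starProjection_weightSpace (μ : Measure K) [IsProbabilityMeasure μ]
    [μ.IsMulLeftInvariant] {B : Type*} [TopologicalSpace B] {f : B → K →ₜ* UnitaryGroup H}
    (hf : Continuous f) (χ : K →ₜ* Circle) (x : H) :
    Continuous fun b => (weightSpace (f b) χ).starProjection x := by
  have hχ : Continuous fun k => ((χ k)⁻¹ : ℂ) :=
    (continuous_subtype_val.comp χ.continuous_toFun).inv₀ fun k => Circle.coe_ne_zero _
  let ev : C(UnitaryGroup H, H) :=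
    ⟨fun U => U.toCLM x, UnitaryGroup.continuous_iff.1 continuous_id x⟩
  have hG : Continuous fun b => ev.comp (f b).toContinuousMap :=
    (ContinuousMap.continuous_postcomp ev).comp
      ((ContinuousMonoidHom.isInducing_toContinuousMap K (UnitaryGroup H)).continuous.comp hf)
  -- On `C(K, H)` the compact-open topology is that of the sup metric, for which averaging against a
  -- unimodular function is a contraction.
  have hL : LipschitzWith 1 fun g : C(K, H) => ∫ k, ((χ k)⁻¹ : ℂ) • g k ∂μ := by
    refine LipschitzWith.mk_one fun g g' => ?_
    rw [dist_eq_norm, ← integral_sub (integrable_of_continuous μ (hχ.fun_smul g.continuous))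
      (integrable_of_continuous μ (hχ.fun_smul g'.continuous))]
    refine (norm_integral_le_of_norm_le_const (C := dist g g')
      (Filter.Eventually.of_forall fun k => ?_)).trans (by simp)
    rw [← smul_sub, norm_smul, norm_inv, Circle.norm_coe, inv_one, one_mul, ← dist_eq_norm]
    exact ContinuousMap.dist_apply_le_dist k
  simp only [starProjection_weightSpace_apply μ]
  exact hL.continuous.comp hG

end WeightSpaces

open MeasureTheory

/-! ### Gluing the bases into a continuous family of unitaries -/

section Assembly

variable {H : Type*} [NormedAddCommGroup H] [InnerProductSpace ℂ H] [CompleteSpace H]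

/-- The unitary carrying one Hilbert basis to another. -/
def UnitaryGroup.ofHilbertBasis {ι : Type*} (v w : HilbertBasis ι ℂ H) : UnitaryGroup H :=
  Unitary.linearIsometryEquiv.symm (v.repr.trans w.repr.symm)

theorem UnitaryGroup.ofHilbertBasis_apply {ι : Type*} (v w : HilbertBasis ι ℂ H) (i : ι) :
    (UnitaryGroup.ofHilbertBasis v w).toCLM (v i) = w i := by
  classical
  change w.repr.symm (v.repr (v i)) = w i
  rw [v.repr_self, w.repr_symm_single]

/-- Unitaries are isometries, so an `ε/3` argument extends strong continuity from a dense span. -/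
theorem UnitaryGroup.continuous_of_dense {B : Type*} [TopologicalSpace B]
    {σ : B → UnitaryGroup H} {s : Set H} (hs : Dense (Submodule.span ℂ s : Set H))
    (h : ∀ x ∈ s, Continuous fun b => (σ b).toCLM x) : Continuous σ := by
  rw [UnitaryGroup.continuous_iff]
  let S : Submodule ℂ H :=
    { carrier := {x | Continuous fun b => (σ b).toCLM x}
      add_mem' := fun {x y} hx hy => by
        simp only [Set.mem_ofPred_eq, map_add] at *; exact hx.add hy
      zero_mem' := by simp only [Set.mem_ofPred_eq, map_zero]; exact continuous_const
      smul_mem' := fun c x hx => by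
        simp only [Set.mem_ofPred_eq, map_smul] at *; exact hx.const_smul c }
  have hle : Submodule.span ℂ s ≤ S := Submodule.span_le.2 h
  intro x
  rw [continuous_iff_continuousAt]
  intro b
  rw [Metric.continuousAt_iff']
  intro ε hε
  obtain ⟨y, hy, hxy⟩ := hs.exists_dist_lt x (show 0 < ε / 3 by positivity)
  have hyc : Continuous fun b => (σ b).toCLM y := hle hy
  have hd : ∀ b, dist ((σ b).toCLM x) ((σ b).toCLM y) < ε / 3 := fun b => by
    rwa [dist_eq_norm, ← map_sub, UnitaryGroup.norm_map, ← dist_eq_norm]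
  filter_upwards [Metric.continuousAt_iff'.1 (hyc.continuousAt (x := b)) (ε / 3) (by positivity)]
    with b' hb'
  have h1 := hd b'
  have h2 := hd b
  rw [dist_comm] at h2
  calc dist ((σ b').toCLM x) ((σ b).toCLM x)
      ≤ dist ((σ b').toCLM x) ((σ b').toCLM y) + dist ((σ b').toCLM y) ((σ b).toCLM y)
        + dist ((σ b).toCLM y) ((σ b).toCLM x) := dist_triangle4 _ _ _ _
    _ < ε := by linarith

variable {K : Type*} [CommGroup K] [TopologicalSpace K]

theorem weightSpace_eq_isotypic (α : K →ₜ* UnitaryGroup H) (χ : K →ₜ* Circle) :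
    weightSpace α χ = isotypic α (Quotient.mk (IrrepModel.setoid K) (characterIrrep χ)) :=
  (isotypicModel_characterIrrep α χ).symm

variable [IsTopologicalGroup K] [CompactSpace K] [MeasurableSpace K] [BorelSpace K]

theorem isProjectionField_weightSpace (μ : Measure K) [IsProbabilityMeasure μ]
    [μ.IsMulLeftInvariant] {B : Type*} [TopologicalSpace B] {f : B → K →ₜ* UnitaryGroup H}
    (hf : Continuous f) (χ : K →ₜ* Circle)
    (h : ∀ b, ¬ FiniteDimensional ℂ (weightSpace (f b) χ)) :
    IsProjectionField fun b => (weightSpace (f b) χ).starProjection where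
  apply_apply b x := Submodule.starProjection_eq_self_iff.2 (Submodule.starProjection_apply_mem _ _)
  inner_apply b x y := Submodule.inner_starProjection_left_eq_right _ x y
  continuous_apply x := continuous_starProjection_weightSpace μ hf χ x
  infinite b := by
    rw [Submodule.range_starProjection]
    exact h b

theorem exists_continuous_conj (μ : Measure K) [IsProbabilityMeasure μ]
    [μ.IsMulLeftInvariant] [μ.IsOpenPosMeasure] [TopologicalSpace.SeparableSpace H]
    {B : Type*} [TopologicalSpace B] [T2Space B] [ParacompactSpace B]
    (hB : FiniteCoveringDim B) (b₀ : B) (C : Set (Irrep K)) (f : B → HomStable K H C)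
    (hf : Continuous f) :
    ∃ σ : B → UnitaryGroup H, Continuous σ ∧
      ∀ b : B, conj (σ b) (f b₀ : K →ₜ* UnitaryGroup H) = f b := by
  -- Characters outside `X` have zero weight space for every `b`, so `X` already exhausts `H`, with
  -- an index set independent of `b`.
  let X : Set (K →ₜ* Circle) := {χ | Quotient.mk (IrrepModel.setoid K) (characterIrrep χ) ∈ C}
  have hinf : ∀ χ : X, ∀ b, ¬ FiniteDimensional ℂ (weightSpace (f b : K →ₜ* UnitaryGroup H) χ) :=
    fun χ b => by
      rw [weightSpace_eq_isotypic]
      exact (mem_homStable_iff.1 (f b).2).2 _ χ.2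
  have hbot : ∀ χ ∉ X, ∀ b, weightSpace (f b : K →ₜ* UnitaryGroup H) χ = ⊥ := fun χ hχ b => by
    rw [weightSpace_eq_isotypic]
    exact (mem_homStable_iff.1 (f b).2).1 _ hχ
  have hfc : Continuous fun b => (f b : K →ₜ* UnitaryGroup H) := continuous_subtype_val.comp hf
  choose e he hPe heo het using fun χ : X =>
    (isProjectionField_weightSpace μ hfc χ (hinf χ)).exists_orthonormal_basis hB
  have hmem : ∀ (χ : X) n b, e χ n b ∈ weightSpace (f b : K →ₜ* UnitaryGroup H) χ := fun χ n b =>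
    Submodule.starProjection_eq_self_iff.1 (hPe χ n b)
  let w : B → X × ℕ → H := fun b i => e i.1 i.2 b
  have hw : ∀ b, Orthonormal ℂ (w b) := fun b => by
    refine ⟨fun i => (heo i.1 b).1 i.2, fun i j hij => ?_⟩
    by_cases h : i.1 = j.1
    · have h2 : i.2 ≠ j.2 := fun h2 => hij (Prod.ext h h2)
      change inner ℂ (e i.1 i.2 b) (e j.1 j.2 b) = 0
      rw [h]
      exact (heo j.1 b).2 h2
    · exact inner_eq_zero_of_mem_weightSpace (fun h' => h (Subtype.ext h')) (hmem _ _ _)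
        (hmem _ _ _)
  have hwt : ∀ b, (Submodule.span ℂ (Set.range (w b)))ᗮ = ⊥ := fun b => by
    rw [Submodule.eq_bot_iff]
    intro x hx
    have hx0 : ∀ (χ : X) n, inner ℂ (e χ n b) x = 0 := fun χ n =>
      (Submodule.mem_orthogonal _ _).1 hx _ (Submodule.subset_span ⟨(χ, n), rfl⟩)
    rw [← Submodule.mem_bot ℂ, ← iSup_weightSpace_orthogonal μ (f b : K →ₜ* UnitaryGroup H),
      ← Submodule.iInf_orthogonal, Submodule.mem_iInf]
    intro χ
    by_cases hχ : χ ∈ X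
    · rw [← Submodule.starProjection_apply_eq_zero_iff]
      -- The projection of `x` to this weight space is still orthogonal to every `e χ n b`, so
      -- completeness of that basis makes it zero.
      refine het ⟨χ, hχ⟩ b _ (Submodule.starProjection_eq_self_iff.2
        (Submodule.starProjection_apply_mem _ _)) fun n => ?_
      rw [← Submodule.inner_starProjection_left_eq_right,
        Submodule.starProjection_eq_self_iff.2 (hmem ⟨χ, hχ⟩ n b)]
      exact hx0 ⟨χ, hχ⟩ n
    · rw [hbot χ hχ, Submodule.bot_orthogonal_eq_top]
      trivial
  let β : ∀ b, HilbertBasis (X × ℕ) ℂ H := fun b => HilbertBasis.mkOfOrthogonalEqBot (hw b) (hwt b)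
  have hβ : ∀ b i, β b i = e i.1 i.2 b := fun b i => by
    rw [HilbertBasis.coe_mkOfOrthogonalEqBot]
  have hdense : Dense (Submodule.span ℂ (Set.range (β b₀)) : Set H) :=
    Submodule.dense_iff_topologicalClosure_eq_top.2 (β b₀).dense_span
  let σ : B → UnitaryGroup H := fun b => UnitaryGroup.ofHilbertBasis (β b₀) (β b)
  have hσ : ∀ b i, (σ b).toCLM (β b₀ i) = β b i := fun b i =>
    UnitaryGroup.ofHilbertBasis_apply _ _ i
  refine ⟨σ, UnitaryGroup.continuous_of_dense hdense ?_, fun b => ?_⟩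
  · rintro _ ⟨i, rfl⟩
    have h : (fun b => (σ b).toCLM (β b₀ i)) = e i.1 i.2 := funext fun b => (hσ b i).trans (hβ b i)
    rw [h]
    exact he i.1 i.2
  · refine ContinuousMonoidHom.ext fun k => ?_
    change σ b * (f b₀ : K →ₜ* UnitaryGroup H) k * (σ b)⁻¹ = (f b : K →ₜ* UnitaryGroup H) k
    rw [mul_inv_eq_iff_eq_mul]
    refine Subtype.ext (ContinuousLinearMap.ext_on hdense ?_)
    rintro _ ⟨i, rfl⟩
    change (σ b).toCLM (((f b₀ : K →ₜ* UnitaryGroup H) k).toCLM (β b₀ i)) =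
      ((f b : K →ₜ* UnitaryGroup H) k).toCLM ((σ b).toCLM (β b₀ i))
    rw [hσ, hβ, hβ, hmem i.1 i.2 b₀ k, hmem i.1 i.2 b k, map_smul, ← hβ b₀ i, hσ, hβ]

end Assembly

end StableRep

end

theorem mainTheorem2
    {H : Type*} [NormedAddCommGroup H] [InnerProductSpace ℂ H] [CompleteSpace H]
    [TopologicalSpace.SeparableSpace H] (hH : ¬ FiniteDimensional ℂ H)
    {E : Type*} [NormedAddCommGroup E] [NormedSpace ℝ E] [FiniteDimensional ℝ E]
    {K : Type*} [CommGroup K] [TopologicalSpace K] [CompactSpace K] [T2Space K]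
    [ChartedSpace E K] [LieGroup 𝓘(ℝ, E) ∞ K]
    {B : Type*} [TopologicalSpace B] [T2Space B] [ParacompactSpace B]
    (hB : StableRep.FiniteCoveringDim B) (b₀ : B)
    (C : Set (StableRep.Irrep K))
    (f : B → StableRep.HomStable K H C) (hf : Continuous f) :
    ∃ σ : B → StableRep.UnitaryGroup H, Continuous σ ∧
      ∀ b : B, StableRep.conj (σ b) (f b₀ : K →ₜ* StableRep.UnitaryGroup H) = f b := by
  have : IsTopologicalGroup K := topologicalGroup_of_lieGroup 𝓘(ℝ, E) ∞
  let _ : MeasurableSpace K := borel K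
  have : BorelSpace K := ⟨rfl⟩
  -- Haar measure normalised on the compact set `⊤`, so that the total mass is `1`.
  let μ : MeasureTheory.Measure K := MeasureTheory.Measure.haarMeasure ⊤
  have : MeasureTheory.IsProbabilityMeasure μ := ⟨MeasureTheory.Measure.haarMeasure_self⟩
  exact StableRep.exists_continuous_conj μ hB b₀ C f hf
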